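/- There is an absolute constant $C'>0$ such that the following holds for every $d\ge 1$, every finite non-empty action set $\mathcal A$ and every discount factor $\gamma\in[0,1)$. Consider discounted Markov decision processes (MDPs) with state space $\mathcal S=[0,1]^d$, action set $\mathcal A$, discount factor $\gamma$, deterministic (measurable) transitions $(s,a)\mapsto s\circ a\in\mathcal S$ and bounded random rewards whose law depends measurably on $(s,a)$. For a stationary randomized policy $\pi$ let $V^\pi(s)=\mathbb E_\pi\big[\sum_{t\ge 0}\gamma^t \mathcal R(s_t,a_t)\,\big|\,s_0=s\big]$, and let $V^*(s)=\sup_\pi V^\pi(s)$ be the optimal value function. An algorithm, given a budget of $T$ samples, makes $T$ successive queries of state-action pairs $(s,a)$; each query may depend (measurably) on an internal random seed and on all earlier samples, and returns a reward drawn from the law $\mathcal R(s,a)$, independently of the past given the query, together with the next state $s\circ a$. After $T$ samples the algorithm outputs an estimate $\hat V_T:\mathcal S\to\mathbb R$ of $V^*$, where each $\hat V_T(s)$ is a measurable function of the seed and of the samples. For every such algorithm and every $\varepsilon\in(0,1)$ there is an MDP of this kind, with rewards in $[-2,2]$ and with $V^*$ $1$-Lipschitz with respect to the Euclidean norm, such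 that for every number of samples $T\ge 1$: if $$\mathbb P\Big[\sup_{s\in\mathcal S}\big|\hat V_T(s)-V^*(s)\big|<\varepsilon\Big]\ \ge\ 1-\varepsilon ,$$ then $$T\ \ge\ C'\,d\,\varepsilon^{-(d+2)}\log(1/\varepsilon).$$ (If the event is not measurable, $\mathbb P$ denotes the outer probability.) -/

import Mathlib

open MeasureTheory ProbabilityTheory

universe u v

/-- The state space `[0,1]^d`, a subset of Euclidean space (so distances are `ℓ²` distances). -/
abbrev StateSpace (d : ℕ) : Type :=
  {x : EuclideanSpace ℝ (Fin d) // ∀ i, x i ∈ Set.Icc (0 : ℝ) 1}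

/-- One sample of a state transition: (state, action, observed reward, next state). -/
abbrev Sample (d : ℕ) (A : Type u) : Type u :=
  StateSpace d × A × ℝ × StateSpace d

/-- A discounted Markov decision process on `[0,1]^d` with action set `A`, deterministic
transitions and random rewards that are bounded by `Rmax`. -/
structure DetMDP (d : ℕ) (A : Type u) [MeasurableSpace A] where
  /-- the state reached from `s` under the action `a` -/
  next : StateSpace d → A → StateSpace d
  measurable_next : Measurable (fun q : StateSpace d × A => next q.1 q.2)
  /-- the law of the random reward, for each state-action pair -/
  reward : Kernel (StateSpace d × A) ℝ
  isMarkovKernel_reward : IsMarkovKernel reward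
  Rmax : ℝ
  Rmax_pos : 0 < Rmax
  reward_bounded : ∀ q, ∀ᵐ r ∂(reward q), r ∈ Set.Icc (-Rmax) Rmax
  /-- the discount factor -/
  γ : ℝ
  γ_nonneg : 0 ≤ γ
  γ_lt_one : γ < 1

attribute [instance] DetMDP.isMarkovKernel_reward

/-- A stationary randomized policy: a probability vector over the actions for each state. -/
abbrev StationaryPolicy (d : ℕ) (A : Type u) [Fintype A] : Type u :=
  StateSpace d → stdSimplex ℝ A

namespace DetMDP

variable {d : ℕ} {A : Type u} [MeasurableSpace A]

/-- The mean reward of a state-action pair. -/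
noncomputable def meanReward (M : DetMDP d A) (s : StateSpace d) (a : A) : ℝ :=
  ∫ r, r ∂(M.reward (s, a))

/-- The expected reward `𝔼_π[R(s_t, a_t) | s_0 = s]` at time `t`, when each action `a_i` is drawn
from `π (s_i)` and `s_{i+1}` is the state reached from `s_i` under `a_i`. -/
noncomputable def expectedReward [Fintype A] (M : DetMDP d A) (π : StationaryPolicy d A) :
    ℕ → StateSpace d → ℝ
  | 0, s => ∑ a, (π s : A → ℝ) a * M.meanReward s a
  | t + 1, s => ∑ a, (π s : A → ℝ) a * expectedReward M π t (M.next s a)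

/-- The value `V^π(s)`, the expected discounted sum of rewards under `π` from the state `s`. -/
noncomputable def value [Fintype A] (M : DetMDP d A) (π : StationaryPolicy d A)
    (s : StateSpace d) : ℝ :=
  ∑' t : ℕ, M.γ ^ t * M.expectedReward π t s

/-- The optimal value function `V^*(s) = sup_π V^π(s)`. -/
noncomputable def optValue [Fintype A] (M : DetMDP d A) (s : StateSpace d) : ℝ :=
  ⨆ π : StationaryPolicy d A, M.value π s

end DetMDP

/-- A (randomized, adaptive) algorithm that estimates the optimal value function from samples.
It has an internal random seed. With a budget of `T` samples, after `t < T` samples it queries a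
state-action pair, which may depend on the seed and on all samples so far; after `T` samples it
outputs an estimate. Following a trajectory of the process, with or without resets, is the
special case in which the queried state is the last observed next state. -/
structure Algorithm (d : ℕ) (A : Type u) [MeasurableSpace A] where
  Seed : Type v
  measurableSpaceSeed : MeasurableSpace Seed
  seedLaw : Measure Seed
  isProbabilityMeasure_seedLaw : IsProbabilityMeasure seedLaw
  query : (T t : ℕ) → Seed × (Fin t → Sample d A) → StateSpace d × A
  measurable_query : ∀ T t, Measurable (query T t)
  estimate : (T : ℕ) → Seed × (Fin T → Sample d A) → StateSpace d → ℝ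
  measurable_estimate : ∀ T s, Measurable (fun h => estimate T h s)

attribute [instance] Algorithm.measurableSpaceSeed Algorithm.isProbabilityMeasure_seedLaw

namespace Algorithm

variable {d : ℕ} {A : Type u} [MeasurableSpace A]

/-- The history after one more sample: at the history `h` the algorithm makes its query, the
reward `r` is observed and the process moves to the next state. -/
def extend (alg : Algorithm.{u, v} d A) (M : DetMDP d A) (T t : ℕ)
    (p : (alg.Seed × (Fin t → Sample d A)) × ℝ) : alg.Seed × (Fin (t + 1) → Sample d A) :=
  let q := alg.query T t p.1
  (p.1.1, Fin.snoc (α := fun _ => Sample d A) p.1.2 (q.1, q.2, p.2, M.next q.1 q.2))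

/-- The joint law of the seed and of the first `t` samples, when the algorithm with budget `T`
runs on the process `M`: given the past, the reward is drawn from the reward law of the queried
state-action pair. -/
noncomputable def historyLaw (alg : Algorithm.{u, v} d A) (M : DetMDP d A) (T : ℕ) :
    (t : ℕ) → Measure (alg.Seed × (Fin t → Sample d A))
  | 0 => alg.seedLaw.map (fun ω => (ω, Fin.elim0))
  | t + 1 => ((historyLaw alg M T t) ⊗ₘ
      (M.reward.comap (alg.query T t) (alg.measurable_query T t))).map (alg.extend M T t)

theorem measurable_extend (alg : Algorithm.{u, v} d A) (M : DetMDP d A) (T t : ℕ) :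
    Measurable (alg.extend M T t) := by
  have hq : Measurable (fun p : (alg.Seed × (Fin t → Sample d A)) × ℝ => alg.query T t p.1) :=
    (alg.measurable_query T t).comp measurable_fst
  refine (measurable_fst.comp measurable_fst).prodMk (measurable_pi_iff.2 fun i => ?_)
  refine Fin.lastCases ?_ (fun j => ?_) i
  · simp only [Fin.snoc_last]
    exact (measurable_fst.comp hq).prodMk ((measurable_snd.comp hq).prodMk
      (measurable_snd.prodMk (M.measurable_next.comp hq)))
  · simp only [Fin.snoc_castSucc]
    exact (measurable_pi_apply j).comp (measurable_snd.comp measurable_fst)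

instance isProbabilityMeasure_historyLaw (alg : Algorithm.{u, v} d A) (M : DetMDP d A) (T t : ℕ) :
    IsProbabilityMeasure (alg.historyLaw M T t) := by
  induction t with
  | zero =>
    exact Measure.isProbabilityMeasure_map (measurable_id.prodMk measurable_const).aemeasurable
  | succ t ih =>
    exact Measure.isProbabilityMeasure_map (alg.measurable_extend M T t).aemeasurable

/-- The probability `ℙ[‖V̂_T - V^*‖_∞ < ε]` that the estimate after `T` samples of the process `M`
is within `ε` of the optimal value function, uniformly over the states. -/
noncomputable def successProb [Fintype A] (alg : Algorithm.{u, v} d A) (M : DetMDP d A) (T : ℕ)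
    (ε : ℝ) : ENNReal :=
  alg.historyLaw M T T
    {h | ⨆ s, ENNReal.ofReal |alg.estimate T h s - M.optValue s| < ENNReal.ofReal ε}

end Algorithm

/-! If no action moves the state and a reward has mean `(1 - γ) * f s`, then `f` is the optimal
value function, so estimating values becomes estimating a regression function. Take `f` to be a sum
of disjoint cones of height `ε` with signs `θ`, centred at a `2ε`-separated set of `n ≥ c d ε⁻ᵈ`
points (`exists_separated_points`). An estimate within `ε` of `f` reveals every sign.

Under a uniform prior on `θ`, the probability of identifying all signs is at most the mean, under
fair rewards, of the product over the cones of `max a b / 2`, where `a` and `b` are the likelihood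
ratios of the two signs. Each factor is dominated by `signPotential`, a linear term plus a multiple
of the Jeffreys divergence (`max_div_two_le_signPotential`). A query meets at most one cone and has
bias `O(ε)`, so one sample multiplies the mean product by at most `1 + O(√ε ε²)`, however adaptive
the queries are (`potential_extend_le`). The product starts at `(1 - errorLevel ε) ^ n`, where
`errorLevel ε` is of order `√ε (log ε⁻¹ + 2)`. Hence it is still at most `exp (-√ε n / 12)` after a
small multiple of `n ε⁻² log ε⁻¹` samples; the logarithm is the price of getting all signs right at
once.

The process has to be chosen before `T`. Summing the exponentially small bound over all budgets
below the threshold costs only a polynomial factor (`sampleConst_mul_exp_lt`), so one sign vector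
defeats all of them. -/

/-! ### Ball volumes and packings of the cube -/

/-- Restricting Euler's integral to `[y, ∞)` bounds the Gamma function from below. -/
theorem rpow_mul_exp_neg_le_Gamma_add_one {s y : ℝ} (hs : 0 ≤ s) (hy : 0 < y) :
    y ^ s * Real.exp (-y) ≤ Real.Gamma (s + 1) := by
  have hint : IntegrableOn (fun x : ℝ => Real.exp (-x) * x ^ s) (Set.Ioi 0) := by
    simpa using Real.GammaIntegral_convergent (s := s + 1) (by linarith)
  rw [Real.Gamma_eq_integral (by linarith)]
  simp only [add_sub_cancel_right]
  calc y ^ s * Real.exp (-y) = ∫ x in Set.Ioi y, y ^ s * Real.exp (-x) := by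
        rw [integral_const_mul, integral_exp_neg_Ioi]
    _ ≤ ∫ x in Set.Ioi y, Real.exp (-x) * x ^ s := by
        refine setIntegral_mono_on ?_ (hint.mono_set (Set.Ioi_subset_Ioi hy.le))
          measurableSet_Ioi fun x hx => ?_
        · exact ((exp_neg_integrableOn_Ioi y one_pos).congr_fun (fun x _ => by simp)
            measurableSet_Ioi).const_mul _
        · rw [mul_comm]
          exact mul_le_mul_of_nonneg_left
            (Real.rpow_le_rpow hy.le (le_of_lt hx) hs) (Real.exp_pos _).le
    _ ≤ ∫ x in Set.Ioi 0, Real.exp (-x) * x ^ s := by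
        refine setIntegral_mono_set hint ?_ (Set.Ioi_subset_Ioi hy.le).eventuallyLE
        filter_upwards [ae_restrict_mem measurableSet_Ioi] with x hx
        exact mul_nonneg (Real.exp_pos _).le (Real.rpow_nonneg (le_of_lt hx) _)

/-- The Gamma function outgrows every exponential. Taking `y = 16π` gives `y ^ (d / 2) = 2 ^ d * 2 ^
d * √π ^ d`, and the spare `2 ^ d` absorbs `d`. This is the source of the factor `d` in the sample
bound. -/
theorem natCast_mul_two_mul_sqrt_pi_pow_le (d : ℕ) :
    (d : ℝ) * (2 ^ d * (Real.sqrt Real.pi) ^ d / Real.Gamma (d / 2 + 1)) ≤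
      Real.exp (16 * Real.pi) := by
  have hd : (0 : ℝ) ≤ d / 2 := by positivity
  have hpi := Real.pi_pos
  have hG := rpow_mul_exp_neg_le_Gamma_add_one hd (y := 16 * Real.pi) (by positivity)
  have hpow : (16 * Real.pi) ^ ((d : ℝ) / 2) = 4 ^ d * (Real.sqrt Real.pi) ^ d := by
    rw [← mul_pow, show (16 * Real.pi) = (4 * Real.sqrt Real.pi) ^ (2 : ℝ) by
      rw [Real.rpow_two, mul_pow, Real.sq_sqrt hpi.le]; norm_num,
      ← Real.rpow_mul (by positivity), mul_div_cancel₀ _ two_ne_zero, Real.rpow_natCast]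
  rw [hpow, Real.exp_neg] at hG
  have hGpos : 0 < Real.Gamma ((d : ℝ) / 2 + 1) := Real.Gamma_pos_of_pos (by positivity)
  have h2 : (d : ℝ) ≤ 2 ^ d := by exact_mod_cast Nat.lt_two_pow_self.le
  have h4 : (4 : ℝ) ^ d = 2 ^ d * 2 ^ d := by rw [← mul_pow]; norm_num
  rw [← mul_div_assoc, div_le_iff₀ hGpos]
  rw [h4, ← div_eq_mul_inv, div_le_iff₀ (Real.exp_pos _)] at hG
  calc (d : ℝ) * (2 ^ d * Real.sqrt Real.pi ^ d)
      ≤ 2 ^ d * (2 ^ d * Real.sqrt Real.pi ^ d) := by gcongr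
    _ ≤ _ := by linarith

/-- The unit cube as a subset of Euclidean space. -/
def unitCube (d : ℕ) : Set (EuclideanSpace ℝ (Fin d)) := {x | ∀ i, x i ∈ Set.Icc (0 : ℝ) 1}

theorem unitCube_eq_preimage (d : ℕ) :
    unitCube d = WithLp.ofLp ⁻¹' (Set.Icc (0 : Fin d → ℝ) 1) := by
  ext x
  simp [unitCube, Pi.le_def, forall_and]

theorem volume_unitCube (d : ℕ) : volume (unitCube d) = 1 := by
  rw [unitCube_eq_preimage, (PiLp.volume_preserving_ofLp (Fin d)).measure_preimage
    measurableSet_Icc.nullMeasurableSet, Real.volume_Icc_pi]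
  simp

theorem isCompact_unitCube (d : ℕ) : IsCompact (unitCube d) := by
  rw [unitCube_eq_preimage]
  exact (EuclideanSpace.equiv (Fin d) ℝ).toHomeomorph.isCompact_preimage.2 isCompact_Icc

/-- The constant in the lower bound for packings of the cube by Euclidean balls. -/
noncomputable def packingConst : ℝ := Real.exp (-(16 * Real.pi))

theorem packingConst_pos : 0 < packingConst := Real.exp_pos _

/-- The unit cube contains a `2ε`-separated set of at least `packingConst * d * ε⁻¹ ^ d` points. -/
theorem exists_separated_points {d : ℕ} (hd : 1 ≤ d) {ε : ℝ} (hε : 0 < ε) :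
    ∃ (n : ℕ) (x : Fin n → StateSpace d), (∀ i j, i ≠ j → 2 * ε ≤ dist (x i) (x j)) ∧
      packingConst * d * ε⁻¹ ^ d ≤ n := by
  have : Nonempty (Fin d) := ⟨⟨0, hd⟩⟩
  lift ε to NNReal using hε.le
  have hε' : ε ≠ 0 := by rintro rfl; simp at hε
  obtain ⟨N, -, hNfin, hN⟩ := Metric.exists_finite_isCover_of_isCompact hε' (isCompact_unitCube d)
  have htop : Metric.packingNumber (2 * ε) (unitCube d) ≠ ⊤ :=
    ((Metric.packingNumber_two_mul_le_externalCoveringNumber ε _).trans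
      hN.externalCoveringNumber_le_encard).trans_lt hNfin.encard_lt_top |>.ne
  set C := Metric.maximalSeparatedSet (2 * ε) (unitCube d) with hC
  have hCfin : C.Finite := by
    rw [← Set.encard_ne_top_iff, Metric.encard_maximalSeparatedSet htop]
    exact htop
  have hCsub : C ⊆ unitCube d := Metric.maximalSeparatedSet_subset
  -- By maximality the closed balls of radius `2ε` around the separated points cover the cube, so
  -- comparing volumes bounds their number from below.
  have hcover := (Metric.isCover_maximalSeparatedSet htop).subset_iUnion_closedBall
  have hsep : Metric.IsSeparated ((2 * ε : NNReal) : ENNReal) C :=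
    Metric.isSeparated_maximalSeparatedSet
  have := hCfin.fintype
  let e := (Fintype.equivFin C).symm
  refine ⟨Fintype.card C, fun i => ⟨(e i).1, hCsub (e i).2⟩, fun i j hij => ?_, ?_⟩
  · have h : ((2 * ε : NNReal) : ENNReal) < edist (e i).1 (e j).1 :=
      hsep (e i).2 (e j).2 (fun h => hij (e.injective (Subtype.ext h)))
    rw [edist_nndist, ENNReal.coe_lt_coe] at h
    exact_mod_cast (NNReal.coe_le_coe.2 h.le)
  · have hvol : (1 : ENNReal) ≤ Fintype.card C *
        ENNReal.ofReal ((2 * ε) ^ d * (Real.sqrt Real.pi ^ d / Real.Gamma (d / 2 + 1))) := by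
      calc (1 : ENNReal) = volume (unitCube d) := (volume_unitCube d).symm
        _ ≤ volume (⋃ y ∈ hCfin.toFinset, Metric.closedBall y ((2 * ε : NNReal) : ℝ)) :=
            measure_mono (by simpa using hcover)
        _ ≤ ∑ y ∈ hCfin.toFinset, volume (Metric.closedBall y ((2 * ε : NNReal) : ℝ)) :=
            measure_biUnion_finset_le _ _
        _ = _ := by
            have hpos : (0 : ℝ) ≤ (2 * ε) ^ d := by positivity
            simp only [EuclideanSpace.volume_closedBall, Finset.sum_const, nsmul_eq_mul]
            rw [ENNReal.ofReal_mul hpos, ENNReal.ofReal_pow (by positivity)]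
            simp
    have hGpos : 0 < Real.Gamma ((d : ℝ) / 2 + 1) := Real.Gamma_pos_of_pos (by positivity)
    have hvol' : (1 : ℝ) ≤ Fintype.card C *
        ((2 * ε) ^ d * (Real.sqrt Real.pi ^ d / Real.Gamma (d / 2 + 1))) := by
      rw [← ENNReal.ofReal_natCast, ← ENNReal.ofReal_mul (by positivity)] at hvol
      exact ENNReal.one_le_ofReal.1 hvol
    have hk := natCast_mul_two_mul_sqrt_pi_pow_le d
    set G := Real.sqrt Real.pi ^ d / Real.Gamma (d / 2 + 1) with hG
    have hG0 : 0 ≤ G := by positivity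
    rw [mul_div_assoc, ← hG] at hk
    have hεd : (0 : ℝ) < (ε : ℝ) ^ d := by positivity
    rw [inv_pow, mul_inv_le_iff₀ hεd, packingConst, Real.exp_neg, inv_mul_le_iff₀ (Real.exp_pos _)]
    calc (d : ℝ) = d * 1 := by ring
      _ ≤ d * (Fintype.card C * ((2 * ε) ^ d * G)) := by gcongr
      _ = (d * (2 ^ d * G)) * (Fintype.card C * ε ^ d) := by rw [mul_pow]; ring
      _ ≤ _ := by gcongr

/-! ### The potential of a single sign -/

/-- The potential of one sign with likelihoods `a` and `b`: a lower bound for the Bayes success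
probability at zero samples, compensated by the Jeffreys divergence. -/
noncomputable def signPotential (A B a b : ℝ) : ℝ :=
  (1 - A) * (a + b) / 2 + B / 2 * ((a - b) * (Real.log a - Real.log b))

theorem signPotential_comm (A B a b : ℝ) : signPotential A B a b = signPotential A B b a := by
  unfold signPotential; ring

/-- The error `A` that `signPotential` can guarantee at the price `B` per unit of divergence. -/
noncomputable def errorLevel (ε : ℝ) : ℝ := Real.sqrt ε / 24 * (Real.log ε⁻¹ + 2)

theorem errorLevel_le {ε : ℝ} (h0 : 0 < ε) (h1 : ε < 1) : errorLevel ε ≤ 1 / 6 := by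
  have hs : 0 < Real.sqrt ε := Real.sqrt_pos.2 h0
  have hs1 : Real.sqrt ε ≤ 1 := Real.sqrt_le_one.2 h1.le
  have hl : Real.log ε⁻¹ = 2 * Real.log (Real.sqrt ε)⁻¹ := by
    rw [Real.log_inv, Real.log_inv, Real.log_sqrt h0.le]; ring
  have h2 : Real.log (Real.sqrt ε)⁻¹ ≤ (Real.sqrt ε)⁻¹ - 1 :=
    Real.log_le_sub_one_of_pos (by positivity)
  have h3 : Real.sqrt ε * Real.log (Real.sqrt ε)⁻¹ ≤ Real.sqrt ε * ((Real.sqrt ε)⁻¹ - 1) := by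
    gcongr
  rw [mul_sub, mul_inv_cancel₀ hs.ne'] at h3
  unfold errorLevel
  rw [hl]
  nlinarith

/-- For comparable likelihoods the linear term suffices, because `errorLevel ε ≤ 1/6`. When `a`
dominates, either `b` is still at least of order `√ε a` and pays for the loss `A`, or the log ratio
is large and the divergence term pays; `log z ≤ z - 1` interpolates between the two. -/
theorem max_div_two_le_signPotential {ε a b : ℝ} (h0 : 0 < ε) (h1 : ε < 1) (ha : 0 < a)
    (hb : 0 < b) : max a b / 2 ≤ signPotential (errorLevel ε) (Real.sqrt ε / 4) a b := by
  wlog hab : b ≤ a generalizing a b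
  · rw [max_comm, signPotential_comm]
    exact this hb ha (le_of_not_ge hab)
  rw [max_eq_left hab]
  have hA := errorLevel_le h0 h1
  have hs : 0 < Real.sqrt ε := Real.sqrt_pos.2 h0
  have hlog : Real.log b ≤ Real.log a := Real.log_le_log hb hab
  unfold signPotential
  set l := Real.log a - Real.log b with hl
  have hl0 : 0 ≤ l := by linarith
  have hJ : 0 ≤ Real.sqrt ε / 4 / 2 * ((a - b) * l) :=
    mul_nonneg (by positivity) (mul_nonneg (by linarith) hl0)
  rcases le_total a (2 * b) with h | h
  · nlinarith
  -- The scale `√ε a / 8` matches the coefficient of `log a - log b` left after `a - b ≥ a / 2`.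
  · have hz : Real.log (8 * b / (Real.sqrt ε * a)) ≤ 8 * b / (Real.sqrt ε * a) - 1 :=
      Real.log_le_sub_one_of_pos (by positivity)
    rw [Real.log_div (by positivity) (by positivity), Real.log_mul (by norm_num) hb.ne',
      Real.log_mul hs.ne' ha.ne', Real.log_sqrt h0.le] at hz
    have hl8 : 0 < Real.log 8 := Real.log_pos (by norm_num)
    have hz' : Real.log ε⁻¹ / 2 + 1 - l ≤ 8 * b / (Real.sqrt ε * a) := by
      rw [Real.log_inv]; linarith
    rw [le_div_iff₀ (by positivity)] at hz'
    have h2 : Real.sqrt ε / 4 / 2 * (a / 2 * l) ≤ Real.sqrt ε / 4 / 2 * ((a - b) * l) := by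
      gcongr; linarith
    have hL : 0 ≤ Real.log ε⁻¹ := Real.log_nonneg ((one_le_inv₀ h0).2 h1.le)
    have hA0 : 0 ≤ errorLevel ε := by unfold errorLevel; positivity
    have h3 : errorLevel ε * (a + b) ≤ errorLevel ε * (3 / 2 * a) := by gcongr; linarith
    have h4 : errorLevel ε * (3 / 2 * a) =
        (Real.log ε⁻¹ / 2 + 1) * (Real.sqrt ε * a) / 8 := by unfold errorLevel; ring
    nlinarith

theorem signPotential_pos {ε a b : ℝ} (h0 : 0 < ε) (h1 : ε < 1) (ha : 0 < a) (hb : 0 < b) :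
    0 < signPotential (errorLevel ε) (Real.sqrt ε / 4) a b :=
  (half_pos (lt_max_of_lt_left ha)).trans_le (max_div_two_le_signPotential h0 h1 ha hb)

/-- The linear term is a martingale under a fair sign. In the divergence term the cross terms
cancel, leaving only the product of the two increments. -/
theorem signPotential_step_eq {A B a b g : ℝ} (ha : 0 < a) (hb : 0 < b) (h0 : 0 ≤ g) (h1 : g < 1) :
    1 / 2 * signPotential A B (a * (1 + g)) (b * (1 - g)) +
      1 / 2 * signPotential A B (a * (1 - g)) (b * (1 + g)) =
    signPotential A B a b +
      B / 2 * ((Real.log (1 + g) - Real.log (1 - g)) * g) * (a + b) := by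
  unfold signPotential
  have hp : (1 + g) ≠ 0 := by linarith
  have hm : (1 - g) ≠ 0 := by linarith
  rw [Real.log_mul ha.ne' hp, Real.log_mul ha.ne' hm, Real.log_mul hb.ne' hp,
    Real.log_mul hb.ne' hm]
  ring

theorem log_one_add_sub_log_one_sub_le {g : ℝ} (h0 : 0 ≤ g) (h1 : g ≤ 1 / 2) :
    Real.log (1 + g) - Real.log (1 - g) ≤ 4 * g := by
  have hm : 0 < 1 - g := by linarith
  rw [← Real.log_div (by linarith) hm.ne']
  refine (Real.log_le_sub_one_of_pos (div_pos (by linarith) hm)).trans ?_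
  rw [sub_le_iff_le_add, div_le_iff₀ hm]
  nlinarith

/-- One observation of bias `g ≤ ε / 2` increases the potential by a factor `1 + O(ε²)`. -/
theorem signPotential_step_le {ε a b g : ℝ} (h0 : 0 < ε) (h1 : ε < 1) (ha : 0 < a) (hb : 0 < b)
    (hg0 : 0 ≤ g) (hg : g ≤ ε / 2) :
    1 / 2 * signPotential (errorLevel ε) (Real.sqrt ε / 4) (a * (1 + g)) (b * (1 - g)) +
      1 / 2 * signPotential (errorLevel ε) (Real.sqrt ε / 4) (a * (1 - g)) (b * (1 + g)) ≤
    (1 + Real.sqrt ε / 2 * ε ^ 2) * signPotential (errorLevel ε) (Real.sqrt ε / 4) a b := by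
  rw [signPotential_step_eq ha hb hg0 (by linarith)]
  have hk : (Real.log (1 + g) - Real.log (1 - g)) * g ≤ ε ^ 2 := by
    have := mul_le_mul_of_nonneg_right
      (log_one_add_sub_log_one_sub_le hg0 (by linarith)) hg0
    nlinarith
  have hw := max_div_two_le_signPotential h0 h1 ha hb
  have hab : (a + b) / 4 ≤ max a b / 2 := by
    linarith [le_max_left a b, le_max_right a b]
  have hs : 0 < Real.sqrt ε := Real.sqrt_pos.2 h0
  calc _ ≤ signPotential (errorLevel ε) (Real.sqrt ε / 4) a b +
        Real.sqrt ε / 4 / 2 * ε ^ 2 *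
          (4 * signPotential (errorLevel ε) (Real.sqrt ε / 4) a b) := by
        gcongr
        linarith
    _ = _ := by ring

theorem signPotential_one_one (A B : ℝ) : signPotential A B 1 1 = 1 - A := by
  simp only [signPotential, sub_self, Real.log_one, mul_zero, add_zero]
  ring

/-- With fewer than the critical number of samples the potential stays exponentially small. -/
theorem one_sub_errorLevel_pow_mul_le {ε : ℝ} (h0 : 0 < ε) (h1 : ε < 1) {N T : ℕ}
    (hT : 12 * ε ^ 2 * T ≤ Real.log ε⁻¹ * N) :
    (1 - errorLevel ε) ^ N * (1 + Real.sqrt ε / 2 * ε ^ 2) ^ T ≤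
      Real.exp (-(Real.sqrt ε * N / 12)) := by
  have hA := errorLevel_le h0 h1
  have hs : 0 < Real.sqrt ε := Real.sqrt_pos.2 h0
  have e1 : 1 - errorLevel ε ≤ Real.exp (-errorLevel ε) := by
    linarith [Real.add_one_le_exp (-errorLevel ε)]
  have e2 : 1 + Real.sqrt ε / 2 * ε ^ 2 ≤ Real.exp (Real.sqrt ε / 2 * ε ^ 2) := by
    linarith [Real.add_one_le_exp (Real.sqrt ε / 2 * ε ^ 2)]
  calc _ ≤ Real.exp (-errorLevel ε) ^ N * Real.exp (Real.sqrt ε / 2 * ε ^ 2) ^ T := by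
        gcongr
        linarith
    _ = Real.exp (N * (-errorLevel ε) + T * (Real.sqrt ε / 2 * ε ^ 2)) := by
        rw [← Real.exp_nat_mul, ← Real.exp_nat_mul, ← Real.exp_add]
    _ ≤ _ := by
        apply Real.exp_le_exp.2
        -- The logarithmic part of `errorLevel` pays for the `T` samples; its summand `2` leaves the
        -- exponent `-√ε N / 12`.
        unfold errorLevel
        have := mul_le_mul_of_nonneg_left hT hs.le
        linarith

/-! ### Choice of the final constant -/

/-- The constant of the lower bound on the sample size. -/
noncomputable def sampleConst : ℝ :=
  min (packingConst / 12) (packingConst ^ 8 / (2 * (Nat.factorial 8 * 12 ^ 8)))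

theorem sampleConst_pos : 0 < sampleConst := by
  have := packingConst_pos
  unfold sampleConst
  positivity

/-- The exponential beats the number of budgets. With `z = √ε N / 12`, `exp (-z) ≤ 8! / z ^ 8`, and
`z ^ 8` is at least of order `d ε⁻¹ ^ (4 * d)`, which covers `d ε⁻¹ ^ (d + 3)` since `d ≥ 1`. The
extra `ε⁻¹` absorbs the logarithm through `log ε⁻¹ ≤ ε⁻¹ * (1 - ε)`, which also supplies the factor
`1 - ε` needed as `ε → 1`. -/
theorem sampleConst_mul_exp_lt {d : ℕ} (hd : 1 ≤ d) {ε : ℝ} (h0 : 0 < ε) (h1 : ε < 1) {N : ℕ}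
    (hN : packingConst * d * ε⁻¹ ^ d ≤ N) :
    sampleConst * d * ε⁻¹ ^ (d + 2) * Real.log ε⁻¹ * Real.exp (-(Real.sqrt ε * N / 12)) <
      1 - ε := by
  have hp := packingConst_pos
  have hx : 1 ≤ ε⁻¹ := (one_le_inv₀ h0).2 h1.le
  have hd' : (1 : ℝ) ≤ d := by exact_mod_cast hd
  have hlog : Real.log ε⁻¹ ≤ ε⁻¹ * (1 - ε) := by
    have := Real.log_le_sub_one_of_pos (inv_pos.2 h0)
    rwa [mul_sub, inv_mul_cancel₀ h0.ne', mul_one]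
  set z := Real.sqrt ε * N / 12 with hz
  have hNpos : (0 : ℝ) < N := lt_of_lt_of_le (by positivity) hN
  have hzpos : 0 < z := by have := Real.sqrt_pos.2 h0; positivity
  have hexp : Real.exp (-z) ≤ Nat.factorial 8 / z ^ 8 := by
    rw [Real.exp_neg, ← inv_div]
    exact inv_anti₀ (by positivity) (Real.pow_div_factorial_le_exp z hzpos.le 8)
  have hz2 : (packingConst * d / 12) ^ 2 * ε⁻¹ ^ d ≤ z ^ 2 := by
    have hsq : (packingConst * d * ε⁻¹ ^ d) ^ 2 ≤ (N : ℝ) ^ 2 := by gcongr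
    have hpow : ε⁻¹ ^ d ≤ ε * (ε⁻¹ ^ d) ^ 2 := by
      have h : ε⁻¹ ≤ ε⁻¹ ^ d := le_self_pow₀ hx (by omega)
      have h' : 1 ≤ ε * ε⁻¹ ^ d := by
        calc (1 : ℝ) = ε * ε⁻¹ := (mul_inv_cancel₀ h0.ne').symm
          _ ≤ _ := by gcongr
      nlinarith [pow_pos (inv_pos.2 h0) d]
    calc (packingConst * d / 12) ^ 2 * ε⁻¹ ^ d
        ≤ (packingConst * d / 12) ^ 2 * (ε * (ε⁻¹ ^ d) ^ 2) := by gcongr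
      _ = ε * (packingConst * d * ε⁻¹ ^ d) ^ 2 / 144 := by ring
      _ ≤ ε * (N : ℝ) ^ 2 / 144 := by gcongr
      _ = z ^ 2 := by rw [hz, div_pow, mul_pow, Real.sq_sqrt h0.le]; norm_num
  have hz8 : (packingConst / 12) ^ 8 * (d * ε⁻¹ ^ (d + 3)) ≤ z ^ 8 := by
    calc (packingConst / 12) ^ 8 * (d * ε⁻¹ ^ (d + 3))
        ≤ (packingConst / 12) ^ 8 * ((d : ℝ) ^ 8 * ε⁻¹ ^ (d * 4)) := by
          gcongr
          · exact le_self_pow₀ hd' (by norm_num)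
          · omega
      _ = ((packingConst * d / 12) ^ 2 * ε⁻¹ ^ d) ^ 4 := by rw [pow_mul]; ring
      _ ≤ (z ^ 2) ^ 4 := by gcongr
      _ = z ^ 8 := by ring
  have hc : sampleConst ≤ packingConst ^ 8 / (2 * (Nat.factorial 8 * 12 ^ 8)) := min_le_right _ _
  have hcp := sampleConst_pos
  have hε1 : 0 < 1 - ε := by linarith
  calc sampleConst * d * ε⁻¹ ^ (d + 2) * Real.log ε⁻¹ * Real.exp (-z)
      ≤ sampleConst * d * ε⁻¹ ^ (d + 2) * (ε⁻¹ * (1 - ε)) * (Nat.factorial 8 / z ^ 8) := by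
        gcongr
    _ ≤ (packingConst ^ 8 / (2 * (Nat.factorial 8 * 12 ^ 8))) * d * ε⁻¹ ^ (d + 2) *
          (ε⁻¹ * (1 - ε)) * (Nat.factorial 8 / z ^ 8) := by gcongr
    _ = ((packingConst / 12) ^ 8 * (d * ε⁻¹ ^ (d + 3)) / z ^ 8) * ((1 - ε) / 2) := by
        have : (Nat.factorial 8 : ℝ) ≠ 0 := by positivity
        rw [show ε⁻¹ ^ (d + 3) = ε⁻¹ ^ (d + 2) * ε⁻¹ from pow_succ _ _]
        generalize ε⁻¹ = x
        field_simp
    _ ≤ 1 * ((1 - ε) / 2) := by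
        gcongr
        exact (div_le_one (by positivity)).2 hz8
    _ < 1 - ε := by linarith

/-! ### Processes that never leave their state -/

/-- The law on `{2, -2}` with mean `2 * x`. -/
noncomputable def biasedReward (x : ℝ) : Measure ℝ :=
  ENNReal.ofReal ((1 + x) / 2) • Measure.dirac 2 + ENNReal.ofReal ((1 - x) / 2) • Measure.dirac (-2)

theorem isProbabilityMeasure_biasedReward {x : ℝ} (hx : |x| ≤ 1) :
    IsProbabilityMeasure (biasedReward x) := by
  obtain ⟨h1, h2⟩ := abs_le.1 hx
  constructor
  simp only [biasedReward, Measure.add_apply, Measure.smul_apply, measure_univ, smul_eq_mul,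
    mul_one]
  rw [← ENNReal.ofReal_add (by linarith) (by linarith)]
  ring_nf
  simp

theorem integral_biasedReward {x : ℝ} (hx : |x| ≤ 1) : ∫ r, r ∂(biasedReward x) = 2 * x := by
  obtain ⟨h1, h2⟩ := abs_le.1 hx
  have hi (c y : ℝ) : Integrable (fun r : ℝ => r) (ENNReal.ofReal c • Measure.dirac y) :=
    (integrable_dirac (by simp)).smul_measure ENNReal.ofReal_ne_top
  rw [biasedReward, integral_add_measure (hi _ _) (hi _ _), integral_smul_measure,
    integral_smul_measure, integral_dirac, integral_dirac, ENNReal.toReal_ofReal (by linarith),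
    ENNReal.toReal_ofReal (by linarith)]
  simp only [smul_eq_mul]
  ring

theorem lintegral_biasedReward (x : ℝ) (φ : ℝ → ENNReal) :
    ∫⁻ r, φ r ∂(biasedReward x) =
      ENNReal.ofReal ((1 + x) / 2) * φ 2 + ENNReal.ofReal ((1 - x) / 2) * φ (-2) := by
  simp [biasedReward, lintegral_add_measure, lintegral_smul_measure]

theorem measurable_biasedReward : Measurable biasedReward := by
  refine Measure.measurable_of_measurable_coe _ fun s hs => ?_
  simp only [biasedReward, Measure.add_apply, Measure.smul_apply, smul_eq_mul]
  fun_prop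

section StayMDP

variable {d : ℕ} {A : Type u} [MeasurableSpace A]

/-- A measurable function on the states with values in `[-1, 1]`. -/
structure UnitValued (d : ℕ) where
  toFun : StateSpace d → ℝ
  measurable_toFun : Measurable toFun
  abs_le_one : ∀ s, |toFun s| ≤ 1

/-- The bias of the reward that makes `f` the value function when no action changes the state. -/
noncomputable def rewardBias (γ : ℝ) (f : UnitValued d) (s : StateSpace d) : ℝ :=
  (1 - γ) * f.toFun s / 2

theorem abs_rewardBias_le {γ : ℝ} (h0 : 0 ≤ γ) (h1 : γ < 1) (f : UnitValued d) (s : StateSpace d) :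
    |rewardBias γ f s| ≤ 1 / 2 := by
  have := f.abs_le_one s
  rw [rewardBias, abs_div, abs_mul, abs_of_pos (by linarith : 0 < 1 - γ), abs_two]
  nlinarith [abs_nonneg (f.toFun s)]

theorem measurable_rewardBias (γ : ℝ) (f : UnitValued d) : Measurable (rewardBias γ f) :=
  (f.measurable_toFun.const_mul _).div_const _

/-- The MDP in which every action keeps the state and the value function is `f`. -/
noncomputable def stayMDP (A : Type u) [MeasurableSpace A] (f : UnitValued d) {γ : ℝ} (h0 : 0 ≤ γ)
    (h1 : γ < 1) : DetMDP d A where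
  next s _ := s
  measurable_next := measurable_fst
  reward :=
    { toFun := fun q => biasedReward (rewardBias γ f q.1)
      measurable' := measurable_biasedReward.comp
        ((measurable_rewardBias γ f).comp measurable_fst) }
  isMarkovKernel_reward := ⟨fun q => isProbabilityMeasure_biasedReward
    ((abs_rewardBias_le h0 h1 f q.1).trans (by norm_num))⟩
  Rmax := 2
  Rmax_pos := two_pos
  reward_bounded q := by
    have hd (c y : ℝ) (hy : y ∈ Set.Icc (-2 : ℝ) 2) :
        ∀ᵐ r ∂(ENNReal.ofReal c • Measure.dirac y), r ∈ Set.Icc (-2 : ℝ) 2 :=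
      Measure.ae_smul_measure ((ae_dirac_iff measurableSet_Icc).2 hy) _
    exact ae_add_measure_iff.2 ⟨hd _ _ (by norm_num), hd _ _ (by norm_num)⟩
  γ := γ
  γ_nonneg := h0
  γ_lt_one := h1

section Value

variable {γ : ℝ} (h0 : 0 ≤ γ) (h1 : γ < 1) (f : UnitValued d)

theorem meanReward_stayMDP (s : StateSpace d) (a : A) :
    (stayMDP A f h0 h1).meanReward s a = (1 - γ) * f.toFun s :=
  (integral_biasedReward ((abs_rewardBias_le h0 h1 f s).trans (by norm_num))).trans
    (by unfold rewardBias; ring)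

variable [Fintype A]

theorem expectedReward_stayMDP (π : StationaryPolicy d A) (t : ℕ) (s : StateSpace d) :
    (stayMDP A f h0 h1).expectedReward π t s = (1 - γ) * f.toFun s := by
  have hπ : ∑ a, (π s : A → ℝ) a = 1 := (π s).2.2
  induction t with
  | zero =>
    simp only [DetMDP.expectedReward, meanReward_stayMDP, ← Finset.sum_mul, hπ, one_mul]
  | succ t ih =>
    have hn (a : A) : (stayMDP A f h0 h1).next s a = s := rfl
    simp only [DetMDP.expectedReward, hn, ih, ← Finset.sum_mul, hπ, one_mul]

theorem optValue_stayMDP [Nonempty A] (s : StateSpace d) :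
    (stayMDP A f h0 h1).optValue s = f.toFun s := by
  have hv (π : StationaryPolicy d A) : (stayMDP A f h0 h1).value π s = f.toFun s := by
    simp only [DetMDP.value, expectedReward_stayMDP]
    change ∑' t : ℕ, γ ^ t * ((1 - γ) * f.toFun s) = _
    rw [tsum_mul_right, tsum_geometric_of_lt_one h0 h1, inv_mul_cancel_left₀ (by linarith)]
  have : Nonempty (StationaryPolicy d A) := by
    classical
    exact ⟨fun _ => ⟨_, single_mem_stdSimplex ℝ (Classical.arbitrary A)⟩⟩
  simp only [DetMDP.optValue, hv, ciSup_const]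

end Value

/-! ### Change of measure to fair rewards -/

/-- The sign of a reward. -/
noncomputable def rewardSign (r : ℝ) : ℝ := if 0 < r then 1 else -1

theorem rewardSign_two : rewardSign 2 = 1 := by norm_num [rewardSign]

theorem rewardSign_neg_two : rewardSign (-2) = -1 := by norm_num [rewardSign]

theorem abs_rewardSign (r : ℝ) : |rewardSign r| = 1 := by
  unfold rewardSign; split_ifs <;> simp

theorem measurable_rewardSign : Measurable rewardSign :=
  Measurable.ite measurableSet_Ioi measurable_const measurable_const

/-- The likelihood ratio of the rewards in a history, between the biases `y` and zero bias. -/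
noncomputable def likelihood {Ω : Type*} (y : StateSpace d → ℝ) {t : ℕ}
    (h : Ω × (Fin t → Sample d A)) : ℝ :=
  ∏ k, (1 + rewardSign (h.2 k).2.2.1 * y (h.2 k).1)

theorem measurable_likelihood {Ω : Type*} [MeasurableSpace Ω] {y : StateSpace d → ℝ}
    (hy : Measurable y) (t : ℕ) :
    Measurable (likelihood y : Ω × (Fin t → Sample d A) → ℝ) := by
  refine Finset.measurable_prod _ fun k _ => ?_
  have hk : Measurable fun h : Ω × (Fin t → Sample d A) => h.2 k :=
    (measurable_pi_apply k).comp measurable_snd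
  exact measurable_const.add ((measurable_rewardSign.comp
    (measurable_fst.comp (measurable_snd.comp (measurable_snd.comp hk)))).mul
      (hy.comp (measurable_fst.comp hk)))

theorem likelihood_pos {Ω A : Type*} {y : StateSpace d → ℝ} (hy : ∀ s, |y s| < 1) {t : ℕ}
    (h : Ω × (Fin t → Sample d A)) : 0 < likelihood y h := by
  refine Finset.prod_pos fun k _ => ?_
  have h1 : |rewardSign (h.2 k).2.2.1 * y (h.2 k).1| < 1 := by
    rw [abs_mul, abs_rewardSign, one_mul]
    exact hy _
  linarith [(abs_lt.1 h1).1]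

section History

variable {γ : ℝ} (h0 : 0 ≤ γ) (h1 : γ < 1) (f : UnitValued d) (alg : Algorithm.{u, v} d A) (T : ℕ)

theorem likelihood_extend (y : StateSpace d → ℝ) {t : ℕ} (h : alg.Seed × (Fin t → Sample d A))
    (r : ℝ) : likelihood y (alg.extend (stayMDP A f h0 h1) T t (h, r)) =
      likelihood y h * (1 + rewardSign r * y (alg.query T t h).1) := by
  simp [likelihood, Algorithm.extend, Fin.prod_univ_castSucc]

theorem lintegral_historyLaw_succ (t : ℕ)
    {φ : alg.Seed × (Fin (t + 1) → Sample d A) → ENNReal} (hφ : Measurable φ) :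
    ∫⁻ h, φ h ∂(alg.historyLaw (stayMDP A f h0 h1) T (t + 1)) =
      ∫⁻ h, (ENNReal.ofReal ((1 + rewardBias γ f (alg.query T t h).1) / 2) *
          φ (alg.extend (stayMDP A f h0 h1) T t (h, 2)) +
        ENNReal.ofReal ((1 - rewardBias γ f (alg.query T t h).1) / 2) *
          φ (alg.extend (stayMDP A f h0 h1) T t (h, -2)))
        ∂(alg.historyLaw (stayMDP A f h0 h1) T t) := by
  have he := alg.measurable_extend (stayMDP A f h0 h1) T t
  rw [Algorithm.historyLaw, lintegral_map hφ he, Measure.lintegral_compProd (f := fun p => φ (alg.extend (stayMDP A f h0 h1) T t p))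
    (hφ.comp he)]
  refine lintegral_congr fun h => ?_
  exact lintegral_biasedReward _ _

/-- The zero value function, under which the rewards carry no information. -/
noncomputable def zeroValue (d : ℕ) : UnitValued d := ⟨fun _ => 0, measurable_const, by simp⟩

theorem lintegral_historyLaw_zeroValue_succ (t : ℕ)
    {φ : alg.Seed × (Fin (t + 1) → Sample d A) → ENNReal} (hφ : Measurable φ) :
    ∫⁻ h, φ h ∂(alg.historyLaw (stayMDP A (zeroValue d) h0 h1) T (t + 1)) =
      ∫⁻ h, (ENNReal.ofReal (1 / 2) * φ (alg.extend (stayMDP A (zeroValue d) h0 h1) T t (h, 2)) +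
        ENNReal.ofReal (1 / 2) * φ (alg.extend (stayMDP A (zeroValue d) h0 h1) T t (h, -2)))
        ∂(alg.historyLaw (stayMDP A (zeroValue d) h0 h1) T t) := by
  rw [lintegral_historyLaw_succ h0 h1 (zeroValue d) alg T t hφ]
  simp [rewardBias, zeroValue]

/-- Seed, queries and transitions do not involve `f`; only the reward probabilities do, so the
density is a product of reward ratios even for adaptive queries. -/
theorem lintegral_historyLaw_eq_likelihood (t : ℕ)
    {φ : alg.Seed × (Fin t → Sample d A) → ENNReal} (hφ : Measurable φ) :
    ∫⁻ h, φ h ∂(alg.historyLaw (stayMDP A f h0 h1) T t) =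
      ∫⁻ h, ENNReal.ofReal (likelihood (rewardBias γ f) h) * φ h
        ∂(alg.historyLaw (stayMDP A (zeroValue d) h0 h1) T t) := by
  induction t with
  | zero => simp [likelihood, Algorithm.historyLaw]
  | succ t ih =>
    have hmb := measurable_rewardBias γ f
    have hq : Measurable fun h => (alg.query T t h).1 := (alg.measurable_query T t).fst
    have he (r : ℝ) : Measurable fun h => alg.extend (stayMDP A f h0 h1) T t (h, r) :=
      (alg.measurable_extend (stayMDP A f h0 h1) T t).comp measurable_prodMk_right
    have hl := measurable_likelihood (Ω := alg.Seed) (A := A) hmb (t + 1)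
    rw [lintegral_historyLaw_succ h0 h1 f alg T t hφ, ih, lintegral_historyLaw_zeroValue_succ]
    · refine lintegral_congr fun h => ?_
      have hpos : 0 < likelihood (rewardBias γ f) h :=
        likelihood_pos (fun s => (abs_rewardBias_le h0 h1 f s).trans_lt (by norm_num)) h
      have hext (r : ℝ) : alg.extend (stayMDP A f h0 h1) T t (h, r) =
        alg.extend (stayMDP A (zeroValue d) h0 h1) T t (h, r) := rfl
      simp only [likelihood_extend, hext, rewardSign_two, rewardSign_neg_two]
      rw [mul_add, ← mul_assoc, ← mul_assoc, ← mul_assoc, ← mul_assoc,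
        ← ENNReal.ofReal_mul hpos.le, ← ENNReal.ofReal_mul hpos.le,
        ← ENNReal.ofReal_mul (by norm_num), ← ENNReal.ofReal_mul (by norm_num)]
      exact congrArg₂ _ (congrArg (ENNReal.ofReal · * _) (by ring))
        (congrArg (ENNReal.ofReal · * _) (by ring))
    · exact hl.ennreal_ofReal.mul hφ
    · exact ((((hmb.comp hq).const_add 1).div_const 2).ennreal_ofReal.mul (hφ.comp (he 2))).add
        ((((hmb.comp hq).const_sub 1).div_const 2).ennreal_ofReal.mul (hφ.comp (he (-2))))

end History

end StayMDP

/-! ### Signed sums of disjoint cones -/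

/-- The real sign encoded by a Boolean. -/
noncomputable def boolSign (b : Bool) : ℝ := if b then 1 else -1

theorem abs_boolSign (b : Bool) : |boolSign b| = 1 := by cases b <;> simp [boolSign]

/-- The cone of slope one and height `ε` over the point `x`. -/
noncomputable def bump {X : Type*} [Dist X] (ε : ℝ) (x s : X) : ℝ := max 0 (ε - dist s x)

section Bump

variable {X : Type*} [MetricSpace X] {ε : ℝ} {n : ℕ} {x : Fin n → X}

theorem bump_nonneg (y s : X) : 0 ≤ bump ε y s := le_max_left _ _

theorem bump_le (h0 : 0 < ε) (y s : X) : bump ε y s ≤ ε :=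
  max_le h0.le (by linarith [dist_nonneg (x := s) (y := y)])

theorem bump_self (h0 : 0 < ε) (y : X) : bump ε y y = ε := by simp [bump, h0.le]

theorem bump_sub_le (y s t : X) : bump ε y s - bump ε y t ≤ dist s t := by
  unfold bump
  have h1 := dist_triangle_left t y s
  have h2 : ε - dist t y ≤ max 0 (ε - dist t y) := le_max_right _ _
  have h3 : 0 ≤ max 0 (ε - dist t y) := le_max_left _ _
  rw [sub_le_iff_le_add]
  exact max_le (by positivity) (by linarith [dist_comm y s, dist_triangle t s y, dist_comm s t])

theorem bump_eq_of_ne_zero {y s : X} (h : bump ε y s ≠ 0) : bump ε y s = ε - dist s y := by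
  unfold bump at *
  rcases le_total (ε - dist s y) 0 with h' | h'
  · exact absurd (max_eq_left h') h
  · exact max_eq_right h'

theorem bump_eq_zero_or (hsep : ∀ i j, i ≠ j → 2 * ε ≤ dist (x i) (x j)) (s : X) :
    (∀ j, bump ε (x j) s = 0) ∨ ∃ i, bump ε (x i) s ≠ 0 ∧ ∀ j, j ≠ i → bump ε (x j) s = 0 := by
  by_cases h : ∀ j, bump ε (x j) s = 0
  · exact Or.inl h
  · push Not at h
    obtain ⟨i, hi⟩ := h
    refine Or.inr ⟨i, hi, fun j hj => max_eq_left ?_⟩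
    have h1 : 0 < bump ε (x i) s := (bump_nonneg _ _).lt_of_ne' hi
    rw [bump_eq_of_ne_zero hi] at h1
    linarith [hsep j i hj, dist_triangle_left (x j) (x i) s]

/-- The sum of the bumps over the points `x i` with signs `θ i`. -/
noncomputable def signedBumps (ε : ℝ) (x : Fin n → X) (θ : Fin n → Bool) (s : X) : ℝ :=
  ∑ i, boolSign (θ i) * bump ε (x i) s

theorem signedBumps_of_forall {s : X} (h : ∀ j, bump ε (x j) s = 0) (θ : Fin n → Bool) :
    signedBumps ε x θ s = 0 := by simp [signedBumps, h]

theorem signedBumps_of_ne {s : X} {i : Fin n} (h : ∀ j, j ≠ i → bump ε (x j) s = 0)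
    (θ : Fin n → Bool) : signedBumps ε x θ s = boolSign (θ i) * bump ε (x i) s :=
  Finset.sum_eq_single i (fun j _ hj => by rw [h j hj, mul_zero]) (by simp)

theorem boolSign_mul_le (b : Bool) (r : ℝ) : boolSign b * r ≤ |r| := by
  rw [← one_mul |r|, ← abs_boolSign b, ← abs_mul]
  exact le_abs_self _

theorem signedBumps_apply_point (h0 : 0 < ε) (hsep : ∀ i j, i ≠ j → 2 * ε ≤ dist (x i) (x j))
    (θ : Fin n → Bool) (i : Fin n) : signedBumps ε x θ (x i) = boolSign (θ i) * ε := by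
  rw [signedBumps_of_ne (i := i) (fun j hj => max_eq_left ?_), bump_self h0]
  linarith [hsep i j hj.symm]

theorem abs_signedBumps_le (h0 : 0 < ε) (hsep : ∀ i j, i ≠ j → 2 * ε ≤ dist (x i) (x j))
    (θ : Fin n → Bool) (s : X) : |signedBumps ε x θ s| ≤ ε := by
  rcases bump_eq_zero_or hsep s with h | ⟨i, -, h⟩
  · rw [signedBumps_of_forall h, abs_zero]
    exact h0.le
  · rw [signedBumps_of_ne h, abs_mul, abs_boolSign, one_mul, abs_of_nonneg (bump_nonneg _ _)]
    exact bump_le h0 _ _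

theorem lipschitzWith_signedBumps (hsep : ∀ i j, i ≠ j → 2 * ε ≤ dist (x i) (x j))
    (θ : Fin n → Bool) : LipschitzWith 1 (signedBumps ε x θ) := by
  refine LipschitzWith.of_le_add fun s t => ?_
  have habs (i : Fin n) (u : X) : |bump ε (x i) u| = bump ε (x i) u :=
    abs_of_nonneg (bump_nonneg _ _)
  rcases bump_eq_zero_or hsep s with hs | ⟨i, hi, hs⟩ <;>
    rcases bump_eq_zero_or hsep t with ht | ⟨j, hj, ht⟩
  · rw [signedBumps_of_forall hs, signedBumps_of_forall ht]
    positivity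
  · rw [signedBumps_of_forall hs, signedBumps_of_ne ht]
    have h1 := boolSign_mul_le (θ j) (-bump ε (x j) t)
    rw [abs_neg, habs] at h1
    linarith [bump_sub_le (ε := ε) (x j) t s, hs j, dist_comm s t]
  · rw [signedBumps_of_ne hs, signedBumps_of_forall ht]
    have h1 := boolSign_mul_le (θ i) (bump ε (x i) s)
    rw [habs] at h1
    linarith [bump_sub_le (ε := ε) (x i) s t, ht i]
  · rw [signedBumps_of_ne hs, signedBumps_of_ne ht]
    by_cases hij : i = j
    · subst hij
      have h1 := boolSign_mul_le (θ i) (bump ε (x i) s - bump ε (x i) t)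
      have h2 : |bump ε (x i) s - bump ε (x i) t| ≤ dist s t :=
        abs_sub_le_iff.2 ⟨bump_sub_le _ _ _, dist_comm s t ▸ bump_sub_le _ _ _⟩
      linarith
    -- On two different cones the values differ by at most `2ε - dist s (x i) - dist t (x j)`, and
    -- separation bounds this by `dist s t`.
    · have h1 := boolSign_mul_le (θ i) (bump ε (x i) s)
      have h2 := boolSign_mul_le (θ j) (-bump ε (x j) t)
      rw [abs_neg, habs] at h2
      rw [habs] at h1
      rw [bump_eq_of_ne_zero hi] at h1 ⊢
      rw [bump_eq_of_ne_zero hj] at h2 ⊢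
      linarith [hsep i j hij, dist_triangle4 (x i) s t (x j), dist_comm (x i) s]

/-- At most one factor differs from `1`. This turns the likelihood of a sign vector into a product
over the cones. -/
theorem one_add_mul_signedBumps (hsep : ∀ i j, i ≠ j → 2 * ε ≤ dist (x i) (x j))
    (θ : Fin n → Bool) (s : X) (c : ℝ) :
    1 + c * signedBumps ε x θ s = ∏ i, (1 + c * (boolSign (θ i) * bump ε (x i) s)) := by
  rcases bump_eq_zero_or hsep s with h | ⟨i, -, h⟩
  · simp [signedBumps_of_forall h, h]
  · rw [signedBumps_of_ne h]
    rw [Finset.prod_eq_single i (fun j _ hj => by rw [h j hj, mul_zero, mul_zero, add_zero])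
      (by simp)]

end Bump

/-! ### Growth of the product potential and identification of the signs -/

section Lower

variable {d : ℕ} {A : Type u} [MeasurableSpace A] {γ ε : ℝ} {n : ℕ} {x : Fin n → StateSpace d}

/-- The value function `signedBumps ε x θ` in bundled form. -/
noncomputable def signedValue (h0 : 0 < ε) (h1 : ε < 1)
    (hsep : ∀ i j, i ≠ j → 2 * ε ≤ dist (x i) (x j)) (θ : Fin n → Bool) : UnitValued d where
  toFun := signedBumps ε x θ
  measurable_toFun := (lipschitzWith_signedBumps hsep θ).continuous.measurable
  abs_le_one s := (abs_signedBumps_le h0 hsep θ s).trans h1.le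

/-- The bias of the rewards near the point `y`. -/
noncomputable def bumpBias (γ ε : ℝ) (y s : StateSpace d) : ℝ := (1 - γ) * bump ε y s / 2

theorem measurable_bumpBias (y : StateSpace d) : Measurable (bumpBias γ ε y) := by
  unfold bumpBias bump
  fun_prop

theorem bumpBias_nonneg (hγ1 : γ < 1) (y s : StateSpace d) : 0 ≤ bumpBias γ ε y s := by
  have := bump_nonneg (ε := ε) y s
  have h : 0 < 1 - γ := by linarith
  unfold bumpBias
  positivity

theorem bumpBias_le (hγ0 : 0 ≤ γ) (h0 : 0 < ε) (y s : StateSpace d) :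
    bumpBias γ ε y s ≤ ε / 2 := by
  have h := bump_nonneg (ε := ε) y s
  have h' := bump_le h0 y s
  unfold bumpBias
  nlinarith

theorem abs_bumpBias_lt (hγ0 : 0 ≤ γ) (hγ1 : γ < 1) (h0 : 0 < ε) (h1 : ε < 1)
    (y s : StateSpace d) : |bumpBias γ ε y s| < 1 := by
  rw [abs_of_nonneg (bumpBias_nonneg hγ1 y s)]
  linarith [bumpBias_le hγ0 h0 y s]

theorem likelihood_signedValue {Ω A : Type*} (h0 : 0 < ε) (h1 : ε < 1)
    (hsep : ∀ i j, i ≠ j → 2 * ε ≤ dist (x i) (x j)) (θ : Fin n → Bool) {t : ℕ}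
    (h : Ω × (Fin t → Sample d A)) :
    likelihood (rewardBias γ (signedValue h0 h1 hsep θ)) h =
      ∏ i, likelihood (fun s => boolSign (θ i) * bumpBias γ ε (x i) s) h := by
  unfold likelihood
  rw [Finset.prod_comm]
  refine Finset.prod_congr rfl fun k _ => ?_
  have := one_add_mul_signedBumps hsep θ (h.2 k).1 (rewardSign (h.2 k).2.2.1 * ((1 - γ) / 2))
  convert! this using 1
  · simp only [rewardBias, signedValue]; ring
  · refine Finset.prod_congr rfl fun i _ => ?_
    unfold bumpBias; ring

/-- The product over all points of the potentials of the likelihoods of the two signs. -/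
noncomputable def potential {Ω : Type*} (γ ε : ℝ) (x : Fin n → StateSpace d) {t : ℕ}
    (h : Ω × (Fin t → Sample d A)) : ℝ :=
  ∏ i, signPotential (errorLevel ε) (Real.sqrt ε / 4) (likelihood (bumpBias γ ε (x i)) h)
    (likelihood (fun s => -bumpBias γ ε (x i) s) h)

theorem measurable_potential {Ω : Type*} [MeasurableSpace Ω] (γ ε : ℝ) (x : Fin n → StateSpace d)
    (t : ℕ) : Measurable (potential γ ε x : Ω × (Fin t → Sample d A) → ℝ) := by
  refine Finset.measurable_prod _ fun i _ => ?_
  have hp : Measurable (likelihood (bumpBias γ ε (x i)) : Ω × (Fin t → Sample d A) → ℝ) :=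
    measurable_likelihood (measurable_bumpBias (x i)) t
  have hm : Measurable
      (likelihood (fun s => -bumpBias γ ε (x i) s) : Ω × (Fin t → Sample d A) → ℝ) :=
    measurable_likelihood (measurable_bumpBias (x i)).neg t
  exact (((hp.add hm).const_mul _).div_const 2).add
    (((hp.sub hm).mul (hp.log.sub hm.log)).const_mul _)

variable (hγ0 : 0 ≤ γ) (hγ1 : γ < 1) (h0 : 0 < ε) (h1 : ε < 1)
  (hsep : ∀ i j, i ≠ j → 2 * ε ≤ dist (x i) (x j))

include hγ0 hγ1 h0 h1

theorem likelihood_bumpBias_pos {Ω A : Type*} (y : StateSpace d) {t : ℕ}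
    (h : Ω × (Fin t → Sample d A)) :
    0 < likelihood (bumpBias γ ε y) h ∧ 0 < likelihood (fun s => -bumpBias γ ε y s) h :=
  ⟨likelihood_pos (fun s => abs_bumpBias_lt hγ0 hγ1 h0 h1 y s) h,
    likelihood_pos (fun s => by rw [abs_neg]; exact abs_bumpBias_lt hγ0 hγ1 h0 h1 y s) h⟩

theorem potential_pos {Ω A : Type*} {t : ℕ} (h : Ω × (Fin t → Sample d A)) :
    0 < potential γ ε x h :=
  Finset.prod_pos fun i _ => by
    obtain ⟨hp, hm⟩ := likelihood_bumpBias_pos hγ0 hγ1 h0 h1 (x i) h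
    exact signPotential_pos h0 h1 hp hm

/-- In each factor the chosen sign has likelihood at most the maximum of the two, hence at most
twice the potential. The `2 ^ n` later cancels against the number of sign vectors. -/
theorem likelihood_signedValue_le (θ : Fin n → Bool) {Ω A : Type*} {t : ℕ}
    (h : Ω × (Fin t → Sample d A)) :
    likelihood (rewardBias γ (signedValue h0 h1 hsep θ)) h ≤ 2 ^ n * potential γ ε x h := by
  rw [likelihood_signedValue, potential,
    show (2 : ℝ) ^ n = ∏ _i : Fin n, 2 by simp, ← Finset.prod_mul_distrib]
  refine Finset.prod_le_prod (fun i _ => ?_) fun i _ => ?_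
  · refine (likelihood_pos (fun s => ?_) h).le
    rw [abs_mul, abs_boolSign, one_mul]
    exact abs_bumpBias_lt hγ0 hγ1 h0 h1 _ _
  · obtain ⟨hp, hm⟩ := likelihood_bumpBias_pos hγ0 hγ1 h0 h1 (x i) h
    have hw := max_div_two_le_signPotential h0 h1 hp hm
    cases θ i
    · simp only [boolSign, Bool.false_eq_true, if_false, neg_one_mul]
      linarith [le_max_right (likelihood (bumpBias γ ε (x i)) h)
        (likelihood (fun s => -bumpBias γ ε (x i) s) h)]
    · simp only [boolSign, if_true, one_mul]
      linarith [le_max_left (likelihood (bumpBias γ ε (x i)) h)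
        (likelihood (fun s => -bumpBias γ ε (x i) s) h)]

variable (alg : Algorithm.{u, v} d A) (T : ℕ)

-- The queried state lies under at most one cone, so a sample changes at most one factor and the
-- growth rate does not depend on `n`.
include hsep in
theorem potential_extend_le (f : UnitValued d) {t : ℕ} (h : alg.Seed × (Fin t → Sample d A)) :
    1 / 2 * potential γ ε x (alg.extend (stayMDP A f hγ0 hγ1) T t (h, 2)) +
      1 / 2 * potential γ ε x (alg.extend (stayMDP A f hγ0 hγ1) T t (h, -2)) ≤
    (1 + Real.sqrt ε / 2 * ε ^ 2) * potential γ ε x h := by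
  have hc : 0 ≤ Real.sqrt ε / 2 * ε ^ 2 := by positivity
  have hpos := potential_pos (x := x) hγ0 hγ1 h0 h1 h
  unfold potential at hpos ⊢
  simp only [likelihood_extend, rewardSign_two, rewardSign_neg_two, one_mul, neg_one_mul, neg_neg,
    ← sub_eq_add_neg]
  set s := (alg.query T t h).1
  rcases bump_eq_zero_or hsep s with hz | ⟨i, -, hz⟩
  · simp only [bumpBias, hz, mul_zero, zero_div, add_zero, sub_zero, mul_one]
    simp only [bumpBias] at hpos
    nlinarith
  · have hz' (j : Fin n) (hj : j ∈ Finset.univ.erase i) : bumpBias γ ε (x j) s = 0 := by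
      simp [bumpBias, hz j (Finset.ne_of_mem_erase hj)]
    obtain ⟨hp, hm⟩ := likelihood_bumpBias_pos hγ0 hγ1 h0 h1 (x i) h
    have hstep := signPotential_step_le h0 h1 hp hm (bumpBias_nonneg hγ1 (x i) s)
      (bumpBias_le hγ0 h0 (x i) s)
    simp only [← Finset.mul_prod_erase Finset.univ _ (Finset.mem_univ i)]
    -- The values `c = 1` and `c = -1` cover the two reward outcomes.
    have herase (c : ℝ) : ∏ j ∈ Finset.univ.erase i,
        signPotential (errorLevel ε) (Real.sqrt ε / 4)
          (likelihood (bumpBias γ ε (x j)) h * (1 + c * bumpBias γ ε (x j) s))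
          (likelihood (fun s => -bumpBias γ ε (x j) s) h * (1 - c * bumpBias γ ε (x j) s)) =
        ∏ j ∈ Finset.univ.erase i, signPotential (errorLevel ε) (Real.sqrt ε / 4)
          (likelihood (bumpBias γ ε (x j)) h) (likelihood (fun s => -bumpBias γ ε (x j) s) h) :=
      Finset.prod_congr rfl fun j hj => by simp [hz' j hj]
    have hplus := herase 1
    have hminus := herase (-1)
    simp only [one_mul, neg_one_mul, sub_neg_eq_add, ← sub_eq_add_neg] at hplus hminus
    rw [hplus, hminus, ← mul_assoc, ← mul_assoc, ← mul_assoc, ← add_mul]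
    refine mul_le_mul_of_nonneg_right hstep (Finset.prod_nonneg fun j _ => ?_)
    obtain ⟨hp, hm⟩ := likelihood_bumpBias_pos hγ0 hγ1 h0 h1 (x j) h
    exact (signPotential_pos h0 h1 hp hm).le

include hsep in
theorem lintegral_potential_le (t : ℕ) :
    ∫⁻ h, ENNReal.ofReal (potential γ ε x h)
      ∂(alg.historyLaw (stayMDP A (zeroValue d) hγ0 hγ1) T t) ≤
    ENNReal.ofReal ((1 - errorLevel ε) ^ n * (1 + Real.sqrt ε / 2 * ε ^ 2) ^ t) := by
  induction t with
  | zero =>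
    simp only [potential, likelihood, Finset.univ_eq_empty, Finset.prod_empty,
      signPotential_one_one, Finset.prod_const, Finset.card_univ, Fintype.card_fin, lintegral_const,
      measure_univ, mul_one, pow_zero, le_refl]
  | succ t ih =>
    rw [lintegral_historyLaw_zeroValue_succ hγ0 hγ1 alg T t
      (measurable_potential γ ε x (t + 1)).ennreal_ofReal]
    have hc : 0 ≤ 1 + Real.sqrt ε / 2 * ε ^ 2 := by positivity
    calc _ ≤ ∫⁻ h, ENNReal.ofReal (1 + Real.sqrt ε / 2 * ε ^ 2) *
          ENNReal.ofReal (potential γ ε x h)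
          ∂(alg.historyLaw (stayMDP A (zeroValue d) hγ0 hγ1) T t) := by
          refine lintegral_mono fun h => ?_
          have hp (r : ℝ) := (potential_pos (x := x) hγ0 hγ1 h0 h1
            (alg.extend (stayMDP A (zeroValue d) hγ0 hγ1) T t (h, r))).le
          have h2 := hp 2
          have h2' := hp (-2)
          rw [← ENNReal.ofReal_mul (by norm_num), ← ENNReal.ofReal_mul (by norm_num),
            ← ENNReal.ofReal_mul hc, ← ENNReal.ofReal_add (by positivity) (by positivity)]
          exact ENNReal.ofReal_le_ofReal
            (potential_extend_le hγ0 hγ1 h0 h1 hsep alg T (zeroValue d) h)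
      _ = ENNReal.ofReal (1 + Real.sqrt ε / 2 * ε ^ 2) * ∫⁻ h, ENNReal.ofReal (potential γ ε x h)
          ∂(alg.historyLaw (stayMDP A (zeroValue d) hγ0 hγ1) T t) :=
          lintegral_const_mul' _ _ ENNReal.ofReal_ne_top
      _ ≤ ENNReal.ofReal (1 + Real.sqrt ε / 2 * ε ^ 2) *
          ENNReal.ofReal ((1 - errorLevel ε) ^ n * (1 + Real.sqrt ε / 2 * ε ^ 2) ^ t) := by gcongr
      _ = _ := by rw [← ENNReal.ofReal_mul hc]; congr 1; ring

/-- No test can identify all signs: the sum over all sign vectors of the probabilities of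
identifying them is controlled by the mean potential. -/
theorem sum_historyLaw_identify_le (t : ℕ) (D : alg.Seed × (Fin t → Sample d A) → Fin n → Bool)
    (hD : ∀ θ, MeasurableSet (D ⁻¹' {θ})) :
    ∑ θ, alg.historyLaw (stayMDP A (signedValue h0 h1 hsep θ) hγ0 hγ1) T t (D ⁻¹' {θ}) ≤
      ENNReal.ofReal (2 ^ n * ((1 - errorLevel ε) ^ n *
        (1 + Real.sqrt ε / 2 * ε ^ 2) ^ t)) := by
  have hm (θ : Fin n → Bool) : Measurable fun h : alg.Seed × (Fin t → Sample d A) =>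
      ENNReal.ofReal (likelihood (rewardBias γ (signedValue h0 h1 hsep θ)) h) *
        (D ⁻¹' {θ}).indicator 1 h :=
    (measurable_likelihood (measurable_rewardBias _ _) t).ennreal_ofReal.mul
      (measurable_one.indicator (hD θ))
  calc _ = ∑ θ, ∫⁻ h, ENNReal.ofReal (likelihood (rewardBias γ (signedValue h0 h1 hsep θ)) h) *
          (D ⁻¹' {θ}).indicator 1 h
          ∂(alg.historyLaw (stayMDP A (zeroValue d) hγ0 hγ1) T t) := by
        refine Finset.sum_congr rfl fun θ _ => ?_
        rw [← lintegral_indicator_one (hD θ),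
          lintegral_historyLaw_eq_likelihood hγ0 hγ1 _ alg T t (measurable_one.indicator (hD θ))]
    _ = ∫⁻ h, ∑ θ, ENNReal.ofReal (likelihood (rewardBias γ (signedValue h0 h1 hsep θ)) h) *
          (D ⁻¹' {θ}).indicator 1 h
          ∂(alg.historyLaw (stayMDP A (zeroValue d) hγ0 hγ1) T t) :=
        (lintegral_finsetSum _ fun θ _ => hm θ).symm
    _ ≤ ∫⁻ h, ENNReal.ofReal (2 ^ n) * ENNReal.ofReal (potential γ ε x h)
          ∂(alg.historyLaw (stayMDP A (zeroValue d) hγ0 hγ1) T t) := by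
        refine lintegral_mono fun h => ?_
        -- For each history only the sign vector that the test selects contributes, so the sum is
        -- bounded by a single likelihood.
        rw [Finset.sum_eq_single (D h) (fun θ _ hθ => by simp [hθ.symm]) (by simp),
          ← ENNReal.ofReal_mul (by positivity)]
        simpa using ENNReal.ofReal_le_ofReal
          (likelihood_signedValue_le hγ0 hγ1 h0 h1 hsep (D h) h)
    _ ≤ _ := by
        rw [lintegral_const_mul' _ _ ENNReal.ofReal_ne_top, ENNReal.ofReal_mul (by positivity)]
        gcongr
        exact lintegral_potential_le hγ0 hγ1 h0 h1 hsep alg T t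

/-- The sum of the success probabilities over all sign vectors. -/
theorem sum_successProb_le [Fintype A] [Nonempty A] :
    ∑ θ, alg.successProb (stayMDP A (signedValue h0 h1 hsep θ) hγ0 hγ1) T ε ≤
      ENNReal.ofReal (2 ^ n * ((1 - errorLevel ε) ^ n *
        (1 + Real.sqrt ε / 2 * ε ^ 2) ^ T)) := by
  classical
  let D (h : alg.Seed × (Fin T → Sample d A)) (i : Fin n) : Bool :=
    decide (0 < alg.estimate T h (x i))
  have hDset (θ : Fin n → Bool) :
      D ⁻¹' {θ} = ⋂ i, {h | decide (0 < alg.estimate T h (x i)) = θ i} := by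
    ext h; simp [D, funext_iff]
  have hD (θ : Fin n → Bool) : MeasurableSet (D ⁻¹' {θ}) := by
    rw [hDset]
    refine MeasurableSet.iInter fun i => ?_
    have hpos : MeasurableSet {h | 0 < alg.estimate T h (x i)} :=
      measurableSet_lt measurable_const (alg.measurable_estimate T (x i))
    cases θ i
    · simpa only [decide_eq_false_iff_not, Set.compl_def] using! hpos.compl
    · simpa only [decide_eq_true_iff] using hpos
  -- The success event need not be measurable, but it lies in the measurable event that the
  -- estimates at the centres have the right signs: there the value is `±ε` and the error is less
  -- than `ε`.
  refine le_trans (Finset.sum_le_sum fun θ _ => measure_mono ?_)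
    (sum_historyLaw_identify_le hγ0 hγ1 h0 h1 hsep alg T T D hD)
  intro h hh
  rw [hDset]
  refine Set.mem_iInter.2 fun i => ?_
  have hi := (le_iSup (fun s => ENNReal.ofReal |alg.estimate T h s -
    (stayMDP A (signedValue h0 h1 hsep θ) hγ0 hγ1).optValue s|) (x i)).trans_lt hh
  rw [ENNReal.ofReal_lt_ofReal_iff h0, optValue_stayMDP] at hi
  change |_ - signedBumps ε x θ (x i)| < ε at hi
  rw [signedBumps_apply_point h0 hsep, abs_lt] at hi
  change decide (0 < alg.estimate T h (x i)) = θ i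
  cases hθ : θ i <;> simp only [hθ, boolSign, Bool.false_eq_true, if_false, if_true] at hi
  · exact decide_eq_false (by linarith)
  · exact decide_eq_true (by linarith)

end Lower

/-! ### Averaging over sign vectors and budgets -/

theorem proposition1 :
    ∃ C' : ℝ, 0 < C' ∧
      ∀ (d : ℕ), 1 ≤ d →
      ∀ (A : Type u) [Fintype A] [Nonempty A] [MeasurableSpace A] [DiscreteMeasurableSpace A]
        (γ : ℝ), 0 ≤ γ → γ < 1 →
      ∀ (alg : Algorithm.{u, v} d A) (ε : ℝ), 0 < ε → ε < 1 →
      ∃ M : DetMDP d A, M.γ = γ ∧ M.Rmax = 2 ∧ LipschitzWith 1 M.optValue ∧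
        ∀ T : ℕ, 1 ≤ T →
          ENNReal.ofReal (1 - ε) ≤ alg.successProb M T ε →
          C' * d * ε⁻¹ ^ (d + 2) * Real.log ε⁻¹ ≤ T := by
  refine ⟨sampleConst, sampleConst_pos, ?_⟩
  intro d hd A _ _ _ _ γ hγ0 hγ1 alg ε h0 h1
  obtain ⟨n, x, hsep, hn⟩ := exists_separated_points hd h0
  let M (θ : Fin n → Bool) := stayMDP A (signedValue h0 h1 hsep θ) hγ0 hγ1
  by_contra! hcon
  have hlip (θ : Fin n → Bool) : LipschitzWith 1 (M θ).optValue := by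
    rw [show (M θ).optValue = signedBumps ε x θ from funext (optValue_stayMDP hγ0 hγ1 _)]
    exact lipschitzWith_signedBumps hsep θ
  set R := sampleConst * d * ε⁻¹ ^ (d + 2) * Real.log ε⁻¹ with hR
  have hlog : 0 ≤ Real.log ε⁻¹ := Real.log_nonneg ((one_le_inv₀ h0).2 h1.le)
  have hc := sampleConst_pos
  have hR0 : 0 ≤ R := by positivity
  set p := Real.exp (-(Real.sqrt ε * n / 12)) with hp
  have hsum (T : ℕ) (hT : T ≤ ⌊R⌋₊) :
      ∑ θ, alg.successProb (M θ) T ε ≤ ENNReal.ofReal (2 ^ n * p) := by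
    refine (sum_successProb_le hγ0 hγ1 h0 h1 hsep alg T).trans (ENNReal.ofReal_le_ofReal ?_)
    gcongr
    refine one_sub_errorLevel_pow_mul_le h0 h1 ?_
    have hTR : (T : ℝ) ≤ R := (Nat.le_floor_iff hR0).1 hT
    have hsc : sampleConst ≤ packingConst / 12 := min_le_left _ _
    calc 12 * ε ^ 2 * T ≤ 12 * ε ^ 2 * R := by gcongr
      _ = 12 * sampleConst * d * ε⁻¹ ^ d * Real.log ε⁻¹ * (ε ^ 2 * ε⁻¹ ^ 2) := by
          rw [hR, pow_add]; ring
      _ = 12 * sampleConst * d * ε⁻¹ ^ d * Real.log ε⁻¹ := by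
          rw [← mul_pow, mul_inv_cancel₀ h0.ne', one_pow, mul_one]
      _ ≤ 12 * (packingConst / 12) * d * ε⁻¹ ^ d * Real.log ε⁻¹ := by gcongr
      _ = Real.log ε⁻¹ * (packingConst * d * ε⁻¹ ^ d) := by ring
      _ ≤ Real.log ε⁻¹ * n := by gcongr
  -- The successful budget may depend on `θ`; summing over all budgets up to `⌊R⌋₊` removes this
  -- dependence and allows the two sums to be exchanged.
  have hfail (θ : Fin n → Bool) : ENNReal.ofReal (1 - ε) ≤
      ∑ T ∈ Finset.Icc 1 ⌊R⌋₊, alg.successProb (M θ) T ε := by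
    obtain ⟨T, hT1, hTs, hTR⟩ := hcon (M θ) rfl rfl (hlip θ)
    exact hTs.trans (Finset.single_le_sum (f := fun T => alg.successProb (M θ) T ε)
      (fun _ _ => zero_le) (Finset.mem_Icc.2 ⟨hT1, Nat.le_floor hTR.le⟩))
  have htotal : ENNReal.ofReal (2 ^ n * (1 - ε)) ≤ ENNReal.ofReal (2 ^ n * (R * p)) := by
    calc ENNReal.ofReal (2 ^ n * (1 - ε)) = ∑ _θ : Fin n → Bool, ENNReal.ofReal (1 - ε) := by
          rw [ENNReal.ofReal_mul (by positivity)]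
          simp [ENNReal.ofReal_pow]
      _ ≤ ∑ θ, ∑ T ∈ Finset.Icc 1 ⌊R⌋₊, alg.successProb (M θ) T ε :=
          Finset.sum_le_sum fun θ _ => hfail θ
      _ = ∑ T ∈ Finset.Icc 1 ⌊R⌋₊, ∑ θ, alg.successProb (M θ) T ε := Finset.sum_comm
      _ ≤ ∑ _T ∈ Finset.Icc 1 ⌊R⌋₊, ENNReal.ofReal (2 ^ n * p) :=
          Finset.sum_le_sum fun T hT => hsum T (Finset.mem_Icc.1 hT).2
      _ = ENNReal.ofReal (⌊R⌋₊ * (2 ^ n * p)) := by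
          rw [ENNReal.ofReal_mul (by positivity)]
          simp
      _ ≤ _ := by
          apply ENNReal.ofReal_le_ofReal
          have := Nat.floor_le hR0
          calc ⌊R⌋₊ * (2 ^ n * p) ≤ R * (2 ^ n * p) := by gcongr
            _ = _ := by ring
  have hε1 : 0 < 1 - ε := by linarith
  have hle := (ENNReal.ofReal_le_ofReal_iff (by positivity)).1 htotal
  exact absurd (le_of_mul_le_mul_left hle (by positivity))
    (not_le.2 (sampleConst_mul_exp_lt hd h0 h1 hn))
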